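/- There is an absolute constant $c>0$ such that the following holds. Let $N_1,n,r\ge 1$ be integers with $n\mid r$, let $n_1,\dots,n_n$ be nonnegative integers, $N_2=\sum_{i=1}^n n_i$, and let $\mathbf L=[\mathbf U_1\mathbf Q_1\ \cdots\ \mathbf U_n\mathbf Q_n]\in\mathbb R^{N_1\times N_2}$ be a random matrix, where $\mathbf U_i\in\mathbb R^{N_1\times r/n}$ and $\mathbf Q_i\in\mathbb R^{r/n\times n_i}$ are random matrices such that the column spaces of $\mathbf U_1,\dots,\mathbf U_n$ are independent, uniformly (i.e. rotation-invariantly) distributed random $r/n$-dimensional subspaces of $\mathbb R^{N_1}$, and for each $i$ the row space of $\mathbf Q_i$ is a uniformly distributed random $r/n$-dimensional subspace of $\mathbb R^{n_i}$. Suppose that $\mathbf L$ has rank $r$ almost surely, and that $m_2$ rows of $\mathbf L$ are sampled uniformly at random with replacement, independently of $\mathbf L$. If $\delta>0$ and $$m_2\ \ge\ 10\,c\,r\,\varphi\,\log\frac{2r}{\delta},\qquad \varphi=\frac{\max(r,\log N_1)}{r},$$ then the sampled rows span the row space of $\mathbf L$ with probability at least $1-\delta-2N_1^{-3}$. (The constant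 $c$ does not depend on $N_1$, $n$, $r$, $n_1,\dots,n_n$, $m_2$, $\delta$ or the joint law of the matrices.) -/

import Mathlib

open MeasureTheory ProbabilityTheory

noncomputable section

namespace RowSampling

/-- The entrywise (Borel) σ-algebra on matrices. -/
instance instMeasurableSpaceMatrix {ι κ : Type*} : MeasurableSpace (Matrix ι κ ℝ) :=
  inferInstanceAs (MeasurableSpace (ι → κ → ℝ))

/-- The column space of a real matrix, a subspace of the Euclidean space. -/
def colSpace {ι κ : Type*} (A : Matrix ι κ ℝ) : Submodule ℝ (EuclideanSpace ℝ ι) :=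
  Submodule.span ℝ (Set.range fun j => WithLp.toLp 2 (A.col j))

/-- The row space of a real matrix, a subspace of the Euclidean space. -/
def rowSpace {ι κ : Type*} (A : Matrix ι κ ℝ) : Submodule ℝ (EuclideanSpace ℝ κ) :=
  Submodule.span ℝ (Set.range fun i => WithLp.toLp 2 (A.row i))

/-- The Borel σ-algebra on the set of all linear subspaces of `ℝ^d` (the disjoint union of the
Grassmannians), where a subspace is identified with its orthogonal projection. -/
instance instMeasurableSpaceSubspace {d : ℕ} :
    MeasurableSpace (Submodule ℝ (EuclideanSpace ℝ (Fin d))) :=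
  MeasurableSpace.comap
    (fun W => (W.starProjection : EuclideanSpace ℝ (Fin d) →L[ℝ] EuclideanSpace ℝ (Fin d)))
    inferInstance

/-- `W` is a random `k`-dimensional subspace of `ℝ^d`: almost surely of dimension `k`, with a
law that is invariant under every orthogonal transformation. The orthogonal group is compact and
acts transitively on the Grassmannian, so that this is the uniform (Haar) distribution on it. -/
structure IsRandomSubspace {Ω : Type*} [MeasurableSpace Ω] (P : Measure Ω) {d : ℕ} (k : ℕ)
    (W : Ω → Submodule ℝ (EuclideanSpace ℝ (Fin d))) : Prop where
  aemeasurable : AEMeasurable W P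
  finrank_eq : ∀ᵐ ω ∂P, Module.finrank ℝ (W ω) = k
  invariant : ∀ O : EuclideanSpace ℝ (Fin d) ≃ₗᵢ[ℝ] EuclideanSpace ℝ (Fin d),
    IdentDistrib (fun ω => (W ω).map O.toLinearEquiv.toLinearMap) W P P

/-- The block matrix `[U₁ Q₁ ⋯ Uₙ Qₙ]`. Its columns are indexed by the pairs
`⟨i, j⟩` (column `j` of block `i`), so that there are `N₂ = ∑ i, nᵢ` of them. -/
def blockMatrix {N₁ n k : ℕ} {d : Fin n → ℕ} (U : Fin n → Matrix (Fin N₁) (Fin k) ℝ)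
    (Q : (i : Fin n) → Matrix (Fin k) (Fin (d i)) ℝ) :
    Matrix (Fin N₁) ((i : Fin n) × Fin (d i)) ℝ :=
  Matrix.of fun a b => (U b.1 * Q b.1) a b.2

/-- The random matrix `L` follows the random subspace clustering model with parameters `r`, `n`
and block widths `d i`: `L = [U₁ Q₁ ⋯ Uₙ Qₙ]`, where the column spaces of the `Uᵢ` are
independent random `r / n`-dimensional subspaces of `ℝ^N₁` and the row space of each `Qᵢ` is a
random `r / n`-dimensional subspace of `ℝ^(d i)`. -/
def FollowsSubspaceModel {Ω : Type*} [MeasurableSpace Ω] (P : Measure Ω) (N₁ n r : ℕ)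
    (d : Fin n → ℕ) (L : Ω → Matrix (Fin N₁) ((i : Fin n) × Fin (d i)) ℝ) : Prop :=
  0 < n ∧ n ∣ r ∧
  ∃ (U : Fin n → Ω → Matrix (Fin N₁) (Fin (r / n)) ℝ)
    (Q : (i : Fin n) → Ω → Matrix (Fin (r / n)) (Fin (d i)) ℝ),
    (∀ i, Measurable (U i)) ∧ (∀ i, Measurable (Q i)) ∧
    (∀ ω, L ω = blockMatrix (fun i => U i ω) (fun i => Q i ω)) ∧
    (∀ i, IsRandomSubspace P (r / n) fun ω => colSpace (U i ω)) ∧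
    iIndepFun (fun i ω => colSpace (U i ω)) P ∧
    (∀ i, IsRandomSubspace P (r / n) fun ω => rowSpace (Q i ω))

/-- `S 0, …, S (m - 1)` are drawn uniformly at random with replacement from `Fin N`:
they are independent, and each is uniformly distributed. -/
structure IsUniformSample {Ω : Type*} [MeasurableSpace Ω] (P : Measure Ω) {m N : ℕ}
    (S : Fin m → Ω → Fin N) : Prop where
  measurable : ∀ j, Measurable (S j)
  uniform : ∀ j i, P.real {ω | S j ω = i} = 1 / (N : ℝ)
  indep : iIndepFun S P

end RowSampling

end

namespace RowSampling

open Module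

/-! Almost surely every choice of `r` distinct rows of `L` already spans its row space, so only a
coupon-collector estimate for the sample remains.

Rank `r` forces the column space of `L` to be the sum of the column spaces of the `Uᵢ`. Rows indexed
by an injective `t` have full rank once this sum is a supplement of `(coordSpan t)ᗮ`. By rotation
invariance the probability `p` of failure is the same for every `r`-dimensional `F` in place of
`coordSpan t` (`measure_transversal_eq`). Averaging over `M ^ r` subspaces spanned by points of the
moment curve, of which a fixed `r`-dimensional sum fails for at most a fraction `r * N / M`
(`card_orthogonal_tuples_le`), gives `M * p ≤ r * N` for all `M > 0`, hence `p = 0`.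

Finally the rows are split into `r` classes of comparable size; a sample that meets every class
contains `r` distinct rows (`measureReal_miss_le`). -/

/-! ### Linear algebra of row and column spaces -/

theorem finrank_colSpace {ι κ : Type*} [Fintype κ] (A : Matrix ι κ ℝ) :
    finrank ℝ (colSpace A) = A.rank := by
  have h : colSpace A = (Submodule.span ℝ (Set.range A.col)).map
      (WithLp.linearEquiv 2 ℝ (ι → ℝ)).symm.toLinearMap := by
    rw [Submodule.map_span, ← Set.range_comp]
    rfl
  rw [h, LinearEquiv.finrank_map_eq, Matrix.rank_eq_finrank_span_cols]

theorem finrank_rowSpace {ι κ : Type*} [Finite ι] [Fintype κ] (A : Matrix ι κ ℝ) :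
    finrank ℝ (rowSpace A) = A.rank := by
  have h : rowSpace A = (Submodule.span ℝ (Set.range A.row)).map
      (WithLp.linearEquiv 2 ℝ (κ → ℝ)).symm.toLinearMap := by
    rw [Submodule.map_span, ← Set.range_comp]
    rfl
  rw [h, LinearEquiv.finrank_map_eq, Matrix.rank_eq_finrank_span_row]

theorem rowSpace_submatrix_le {ι κ σ : Type*} (A : Matrix ι κ ℝ) (s : σ → ι) :
    rowSpace (A.submatrix s id) ≤ rowSpace A := by
  refine Submodule.span_mono ?_
  rintro _ ⟨i, rfl⟩
  exact ⟨s i, rfl⟩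

theorem rowSpace_submatrix_eq {ι κ σ τ : Type*} [Finite ι] [Finite τ] [Fintype κ]
    (A : Matrix ι κ ℝ) (s : σ → ι) (t : τ → σ)
    (h : (A.submatrix (s ∘ t) id).rank = A.rank) :
    rowSpace (A.submatrix s id) = rowSpace A := by
  refine le_antisymm (rowSpace_submatrix_le A s) ?_
  have h₁ : rowSpace (A.submatrix (s ∘ t) id) = rowSpace A := by
    refine Submodule.eq_of_le_of_finrank_eq (rowSpace_submatrix_le A _) ?_
    rw [finrank_rowSpace, finrank_rowSpace, h]
  rw [← h₁]
  exact rowSpace_submatrix_le (A.submatrix s id) t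

/-- The span of the standard basis vectors indexed by the range of `t`. -/
def coordSpan {ι τ : Type*} [Fintype ι] [DecidableEq ι] (t : τ → ι) :
    Submodule ℝ (EuclideanSpace ℝ ι) :=
  Submodule.span ℝ (Set.range fun a => EuclideanSpace.single (t a) (1 : ℝ))

theorem finrank_coordSpan {ι τ : Type*} [Fintype ι] [DecidableEq ι] [Fintype τ] {t : τ → ι}
    (ht : Function.Injective t) : finrank ℝ (coordSpan t) = Fintype.card τ := by
  have h : LinearIndependent ℝ fun a => EuclideanSpace.single (t a) (1 : ℝ) := by
    have := ((EuclideanSpace.basisFun ι ℝ).orthonormal.linearIndependent).comp t ht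
    simpa [Function.comp_def] using this
  exact finrank_span_eq_card h

/-- Restriction to the coordinates in `t` is surjective and kills `(coordSpan t)ᗮ`, so the image of
`colSpace A` alone must be everything. -/
theorem rank_submatrix_of_sup_eq_top {ι κ τ : Type*} [Fintype ι] [DecidableEq ι] [Fintype κ]
    [Fintype τ] (A : Matrix ι κ ℝ) {t : τ → ι} (ht : Function.Injective t)
    (h : colSpace A ⊔ (coordSpan t)ᗮ = ⊤) :
    (A.submatrix t id).rank = Fintype.card τ := by
  let π : EuclideanSpace ℝ ι →ₗ[ℝ] EuclideanSpace ℝ τ :=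
    (WithLp.linearEquiv 2 ℝ (τ → ℝ)).symm.toLinearMap ∘ₗ LinearMap.funLeft ℝ ℝ t ∘ₗ
      (WithLp.linearEquiv 2 ℝ (ι → ℝ)).toLinearMap
  have hπ : Function.Surjective π :=
    (WithLp.linearEquiv 2 ℝ (τ → ℝ)).symm.surjective.comp
      ((LinearMap.funLeft_surjective_of_injective ℝ ℝ t ht).comp
        (WithLp.linearEquiv 2 ℝ (ι → ℝ)).surjective)
  have h₁ : (coordSpan t)ᗮ.map π = ⊥ := by
    rw [eq_bot_iff]
    rintro _ ⟨x, hx, rfl⟩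
    rw [Submodule.mem_bot]
    ext a
    have := (Submodule.mem_orthogonal _ _).1 hx _ (Submodule.subset_span ⟨a, rfl⟩)
    rw [EuclideanSpace.inner_single_left, map_one, one_mul] at this
    exact this
  have h₂ : (colSpace A).map π = colSpace (A.submatrix t id) := by
    unfold colSpace
    rw [Submodule.map_span, ← Set.range_comp]
    rfl
  have h₃ : colSpace (A.submatrix t id) = ⊤ := by
    rw [← h₂, ← sup_bot_eq ((colSpace A).map π), ← h₁, ← Submodule.map_sup, h,
      Submodule.map_top, LinearMap.range_eq_top.2 hπ]
  rw [← finrank_colSpace, h₃, finrank_top, finrank_euclideanSpace]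

theorem finrank_iSup_colSpace_le {N n k : ℕ} (U : Fin n → Matrix (Fin N) (Fin k) ℝ) :
    finrank ℝ ↥(⨆ i, colSpace (U i)) ≤ n * k := by
  have h : ⨆ i, colSpace (U i) = Submodule.span ℝ
      (Set.range fun p : Fin n × Fin k => WithLp.toLp 2 ((U p.1).col p.2)) := by
    unfold colSpace
    rw [← Submodule.span_iUnion]
    congr 1
    ext x
    simp
  rw [h]
  simpa [Set.finrank] using finrank_range_le_card (R := ℝ)
    (b := fun p : Fin n × Fin k => WithLp.toLp 2 ((U p.1).col p.2))

theorem colSpace_blockMatrix_le {N n k : ℕ} {d : Fin n → ℕ} (U : Fin n → Matrix (Fin N) (Fin k) ℝ)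
    (Q : (i : Fin n) → Matrix (Fin k) (Fin (d i)) ℝ) :
    colSpace (blockMatrix U Q) ≤ ⨆ i, colSpace (U i) := by
  refine Submodule.span_le.2 ?_
  rintro _ ⟨⟨i, j⟩, rfl⟩
  refine le_iSup (fun i => colSpace (U i)) i ?_
  have h : WithLp.toLp 2 ((blockMatrix U Q).col ⟨i, j⟩) =
      ∑ l, Q i l j • WithLp.toLp 2 ((U i).col l) := by
    ext a
    simp [blockMatrix, Matrix.mul_apply, mul_comm]
  change WithLp.toLp 2 ((blockMatrix U Q).col ⟨i, j⟩) ∈ _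
  rw [h]
  exact Submodule.sum_mem _ fun l _ => Submodule.smul_mem _ _ (Submodule.subset_span ⟨l, rfl⟩)

/-- If `[U₁ Q₁ ⋯ Uₙ Qₙ]` has the largest possible rank `n * k`, its column space is the sum of
the column spaces of the `Uᵢ`. -/
theorem colSpace_blockMatrix_eq {N n k : ℕ} {d : Fin n → ℕ} (U : Fin n → Matrix (Fin N) (Fin k) ℝ)
    (Q : (i : Fin n) → Matrix (Fin k) (Fin (d i)) ℝ) (h : (blockMatrix U Q).rank = n * k) :
    colSpace (blockMatrix U Q) = ⨆ i, colSpace (U i) := by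
  refine Submodule.eq_of_le_of_finrank_le (colSpace_blockMatrix_le U Q) ?_
  rw [finrank_colSpace, h]
  exact finrank_iSup_colSpace_le U

/-! ### Counting degenerate tuples -/

/-- If every nonzero vector is orthogonal to at most `N` of the vectors `v b j` with `b` fixed,
then few tuples `x` are such that a vector of `K` is orthogonal to all the `v b (x b)`. -/
theorem card_orthogonal_tuples_le {E : Type*} [NormedAddCommGroup E] [InnerProductSpace ℝ E]
    [FiniteDimensional ℝ E] (N M : ℕ) : ∀ (k : ℕ) (v : Fin k → Fin M → E)
    (_ : ∀ b w, w ≠ 0 → {j | inner ℝ (v b j) w = 0}.ncard ≤ N)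
    (K : Submodule ℝ E) (_ : finrank ℝ K ≤ k),
    M * {x : Fin k → Fin M | ∃ w ∈ K, w ≠ 0 ∧ ∀ b, inner ℝ (v b (x b)) w = 0}.ncard
      ≤ k * N * M ^ k := by
  classical
  intro k
  induction k with
  | zero =>
    intro v _ K hK
    have hK' : K = ⊥ := Submodule.finrank_eq_zero.1 (Nat.le_zero.1 hK)
    subst hK'
    simp
  | succ k ih =>
    intro v hv K hK
    by_cases hbot : K = ⊥
    · subst hbot
      simp
    -- Split on the first entry `j`. If `v 0 j` is orthogonal to `w₀` (at most `N` values), all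
    -- tails are counted. Otherwise intersecting `K` with the complement of `v 0 j` loses a
    -- dimension and induction applies.
    obtain ⟨w₀, hw₀K, hw₀⟩ := K.ne_bot_iff.1 hbot
    let J : Finset (Fin M) := {j | inner ℝ (v 0 j) w₀ = 0}
    have hJ : J.card ≤ N := by
      have := hv 0 w₀ hw₀
      rwa [Set.ncard_eq_toFinset_card', Set.toFinset_ofFinset] at this
    let bad : Set (Fin (k + 1) → Fin M) :=
      {x | ∃ w ∈ K, w ≠ 0 ∧ ∀ b, inner ℝ (v b (x b)) w = 0}
    let c : Fin M → ℕ := fun j => {y : Fin k → Fin M | Fin.cons j y ∈ bad}.ncard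
    have hsum : bad.ncard = ∑ j, c j := by
      have e : bad ≃ (j : Fin M) × {y : Fin k → Fin M | Fin.cons j y ∈ bad} :=
        { toFun := fun x => ⟨x.1 0, Fin.tail x.1, by
            change Fin.cons (x.1 0) (Fin.tail x.1) ∈ bad
            rw [Fin.cons_self_tail]
            exact x.2⟩
          invFun := fun p => ⟨Fin.cons p.1 p.2.1, p.2.2⟩
          left_inv := fun x => Subtype.ext (Fin.cons_self_tail x.1)
          right_inv := fun _ => rfl }
      change Nat.card bad = _
      rw [Nat.card_congr e, Nat.card_sigma]
      rfl
    have hc₁ : ∀ j, M * c j ≤ M ^ (k + 1) := fun j => by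
      have : c j ≤ M ^ k := by
        have := Set.ncard_le_card {y : Fin k → Fin M | Fin.cons j y ∈ bad}
        simpa using this
      calc M * c j ≤ M * M ^ k := by gcongr
        _ = _ := by ring
    have hc₂ : ∀ j, j ∉ J → M * c j ≤ k * N * M ^ k := fun j hj => by
      let K' : Submodule ℝ E := K ⊓ (ℝ ∙ v 0 j)ᗮ
      have hlt : K' < K := by
        refine lt_of_le_of_ne inf_le_left fun h => hj ?_
        have := (Submodule.mem_inf.1 (h.symm ▸ hw₀K : w₀ ∈ K')).2
        simpa [J] using (Submodule.mem_orthogonal_singleton_iff_inner_right.1 this)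
      have hK' : finrank ℝ K' ≤ k := by
        have := Submodule.finrank_lt_finrank_of_lt hlt
        omega
      refine le_trans (Nat.mul_le_mul_left M (Set.ncard_le_ncard ?_ (Set.toFinite _)))
        (ih (fun b => v b.succ) (fun b => hv b.succ) K' hK')
      rintro y ⟨w, hwK, hw, h⟩
      refine ⟨w, ⟨hwK, ?_⟩, hw, fun b => by simpa using h b.succ⟩
      exact Submodule.mem_orthogonal_singleton_iff_inner_right.2 (by simpa using h 0)
    change M * bad.ncard ≤ _
    rw [hsum, Finset.mul_sum]
    calc ∑ j, M * c j ≤ ∑ j, ((if j ∈ J then M ^ (k + 1) else 0) + k * N * M ^ k) := by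
          refine Finset.sum_le_sum fun j _ => ?_
          split_ifs with h
          · exact (hc₁ j).trans (Nat.le_add_right _ _)
          · simpa using hc₂ j h
      _ = J.card * M ^ (k + 1) + M * (k * N * M ^ k) := by
          simp [Finset.sum_add_distrib]
      _ ≤ N * M ^ (k + 1) + M * (k * N * M ^ k) := by gcongr
      _ = (k + 1) * N * M ^ (k + 1) := by ring

/-! ### Measurability of general position and rotations -/

/-- Pairing the sum with `x` gives the sum of the squared norms of the projections of `x`, so each
of them vanishes. -/
theorem sum_starProjection_ker {E ι : Type*} [NormedAddCommGroup E] [InnerProductSpace ℝ E]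
    [FiniteDimensional ℝ E] [Fintype ι] (V : ι → Submodule ℝ E) (x : E)
    (h : (∑ i, (V i).starProjection) x = 0) (i : ι) : x ∈ (V i)ᗮ := by
  have h₁ : ∑ i, ‖(V i).starProjection x‖ ^ 2 = 0 := by
    have : inner ℝ ((∑ i, (V i).starProjection) x) x = 0 := by rw [h, inner_zero_left]
    rw [sum_apply, sum_inner] at this
    rw [← this]
    refine Finset.sum_congr rfl fun i _ => ?_
    rw [← real_inner_self_eq_norm_sq, Submodule.inner_starProjection_left_eq_right,
      Submodule.inner_starProjection_left_eq_right]
    congr 1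
    exact DFunLike.congr_fun (V i).isIdempotentElem_starProjection x
  have h₂ := (Finset.sum_eq_zero_iff_of_nonneg fun i _ => by positivity).1 h₁ i (Finset.mem_univ i)
  exact (Submodule.starProjection_apply_eq_zero_iff _).1 (by simpa using h₂)

/-- Finitely many subspaces span the whole space if and only if the sum of their orthogonal
projections is invertible. -/
theorem iSup_eq_top_iff_det_ne_zero {E ι : Type*} [NormedAddCommGroup E] [InnerProductSpace ℝ E]
    [FiniteDimensional ℝ E] [Fintype ι] (V : ι → Submodule ℝ E) :
    ⨆ i, V i = ⊤ ↔ (∑ i, (V i).starProjection).det ≠ 0 := by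
  have h₀ : (∑ i, (V i).starProjection).det = 0 ↔ _ :=
    LinearMap.det_eq_zero_iff_ker_ne_bot (f := (∑ i, (V i).starProjection : E →L[ℝ] E).toLinearMap)
  rw [Ne, h₀, not_not, ← Submodule.orthogonal_eq_bot_iff, ← Submodule.iInf_orthogonal]
  have h₁ : (∑ i, (V i).starProjection : E →L[ℝ] E).toLinearMap.ker = ⨅ i, (V i)ᗮ := by
    ext x
    rw [LinearMap.mem_ker, Submodule.mem_iInf]
    refine ⟨fun h i => sum_starProjection_ker V x h i, fun h => ?_⟩
    change (∑ i, (V i).starProjection) x = 0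
    rw [sum_apply]
    exact Finset.sum_eq_zero fun i _ => (Submodule.starProjection_apply_eq_zero_iff _).2 (h i)
  rw [h₁]

variable {N : ℕ}

theorem measurable_starProjection : Measurable
    fun W : Submodule ℝ (EuclideanSpace ℝ (Fin N)) => W.starProjection :=
  Measurable.of_comap_le le_rfl

theorem measurable_submodule_map
    (O : EuclideanSpace ℝ (Fin N) ≃ₗᵢ[ℝ] EuclideanSpace ℝ (Fin N)) :
    Measurable fun W : Submodule ℝ (EuclideanSpace ℝ (Fin N)) =>
      W.map O.toLinearEquiv.toLinearMap := by
  refine measurable_comap_iff.2 ?_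
  have h : (fun W : Submodule ℝ (EuclideanSpace ℝ (Fin N)) => W.starProjection) ∘
      (fun W : Submodule ℝ (EuclideanSpace ℝ (Fin N)) => W.map O.toLinearEquiv.toLinearMap) =
      (fun T : EuclideanSpace ℝ (Fin N) →L[ℝ] EuclideanSpace ℝ (Fin N) =>
        (O : EuclideanSpace ℝ (Fin N) →L[ℝ] EuclideanSpace ℝ (Fin N)) ∘L T ∘L
          (O.symm : EuclideanSpace ℝ (Fin N) →L[ℝ] EuclideanSpace ℝ (Fin N))) ∘
      (fun W : Submodule ℝ (EuclideanSpace ℝ (Fin N)) => W.starProjection) := by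
    ext1 W
    refine ContinuousLinearMap.ext fun x => ?_
    exact Submodule.starProjection_map_apply O W x
  rw [h]
  refine Measurable.comp (Continuous.measurable ?_) measurable_starProjection
  fun_prop

/-- The families of subspaces whose sum is a supplement of `Fᗮ`. -/
def transversal {n : ℕ} (F : Submodule ℝ (EuclideanSpace ℝ (Fin N))) :
    Set (Fin n → Submodule ℝ (EuclideanSpace ℝ (Fin N))) :=
  {V | (⨆ i, V i) ⊔ Fᗮ = ⊤}

/-- The condition is the nonvanishing of a determinant that depends continuously on the projections,
and these generate the σ-algebra. -/
theorem measurableSet_transversal {n : ℕ} (F : Submodule ℝ (EuclideanSpace ℝ (Fin N))) :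
    MeasurableSet (transversal (n := n) F) := by
  have h : transversal (n := n) F =
      (fun V : Fin n → Submodule ℝ (EuclideanSpace ℝ (Fin N)) =>
        ((∑ i, (V i).starProjection) + (Fᗮ).starProjection).det) ⁻¹' {0}ᶜ := by
    ext V
    have := iSup_eq_top_iff_det_ne_zero fun o : Option (Fin n) => o.elim Fᗮ V
    rw [Fintype.sum_option, iSup_option, add_comm, sup_comm] at this
    exact this
  rw [h]
  refine Measurable.comp (g := ContinuousLinearMap.det)
    ContinuousLinearMap.continuous_det.measurable ?_ (measurableSet_singleton 0).compl
  refine Measurable.add_const ?_ _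
  exact Finset.measurable_sum _ fun i _ => measurable_starProjection.comp (measurable_pi_apply i)

theorem map_mem_transversal_iff {n : ℕ} (F : Submodule ℝ (EuclideanSpace ℝ (Fin N)))
    (O : EuclideanSpace ℝ (Fin N) ≃ₗᵢ[ℝ] EuclideanSpace ℝ (Fin N))
    (V : Fin n → Submodule ℝ (EuclideanSpace ℝ (Fin N))) :
    (fun i => (V i).map O.toLinearEquiv.toLinearMap) ∈
      transversal (F.map O.toLinearEquiv.toLinearMap) ↔ V ∈ transversal F := by
  change (⨆ i, (V i).map O.toLinearEquiv.toLinearMap) ⊔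
    (F.map O.toLinearEquiv.toLinearMap)ᗮ = ⊤ ↔ (⨆ i, V i) ⊔ Fᗮ = ⊤
  rw [← Submodule.map_iSup, ← Submodule.map_orthogonal_equiv,
    ← Submodule.map_sup]
  exact Submodule.map_eq_top_iff (e := O.toLinearEquiv)

/-- The orthogonal group acts transitively on the subspaces of a given dimension. -/
theorem exists_isometry_map_eq {E : Type*} [NormedAddCommGroup E] [InnerProductSpace ℝ E]
    [FiniteDimensional ℝ E] (F G : Submodule ℝ E) (h : finrank ℝ F = finrank ℝ G) :
    ∃ O : E ≃ₗᵢ[ℝ] E, F.map O.toLinearEquiv.toLinearMap = G := by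
  let e : F ≃ₗᵢ[ℝ] G := (stdOrthonormalBasis ℝ F).equiv (stdOrthonormalBasis ℝ G) (finCongr h)
  -- An isometry from `F` into the whole space extends to the whole space, and is onto by dimension.
  let O := (G.subtypeₗᵢ.comp e.toLinearIsometry).extend.toLinearIsometryEquiv rfl
  refine ⟨O, Submodule.eq_of_le_of_finrank_eq ?_ ?_⟩
  · rintro _ ⟨x, hx, rfl⟩
    have := (G.subtypeₗᵢ.comp e.toLinearIsometry).extend_apply ⟨x, hx⟩
    change (G.subtypeₗᵢ.comp e.toLinearIsometry).extend x ∈ G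
    rw [this]
    exact (e ⟨x, hx⟩).2
  · rw [LinearEquiv.finrank_map_eq, h]

/-! ### The moment curve -/

/-- The point `(1, t, t ^ 2, …)` of the moment curve. -/
def momentVec (N : ℕ) (t : ℝ) : EuclideanSpace ℝ (Fin N) := WithLp.toLp 2 fun i => t ^ (i : ℕ)

/-- The inner product with `w` is a nonzero polynomial in the parameter, with coefficients `w i`, so
it has few roots. -/
theorem ncard_momentVec_orthogonal_le {M : ℕ} {t : Fin M → ℝ} (ht : Function.Injective t)
    (w : EuclideanSpace ℝ (Fin N)) (hw : w ≠ 0) :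
    {j | inner ℝ (momentVec N (t j)) w = 0}.ncard ≤ N := by
  let p : Polynomial ℝ := ∑ i : Fin N, Polynomial.C (w i) * Polynomial.X ^ (i : ℕ)
  have hp : p ≠ 0 := by
    intro h
    refine hw ?_
    ext i
    have := congrArg (fun q => Polynomial.coeff q (i : ℕ)) h
    simpa [p, Polynomial.finsetSum_coeff, Polynomial.coeff_X_pow, Fin.val_inj] using this
  have hdeg : p.natDegree ≤ N := by
    refine Polynomial.natDegree_sum_le_of_forall_le _ _ fun i _ => ?_
    exact (Polynomial.natDegree_C_mul_X_pow_le _ _).trans i.2.le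
  have hmem : ∀ j, inner ℝ (momentVec N (t j)) w = 0 → t j ∈ (p.roots.toFinset : Set ℝ) := by
    intro j hj
    simp only [Finset.mem_coe, Multiset.mem_toFinset, Polynomial.mem_roots hp]
    rw [Polynomial.IsRoot, ← hj]
    simp [p, Polynomial.eval_finsetSum, momentVec, PiLp.inner_apply]
  calc {j | inner ℝ (momentVec N (t j)) w = 0}.ncard
      ≤ (p.roots.toFinset : Set ℝ).ncard :=
        Set.ncard_le_ncard_of_injOn t hmem ht.injOn (Finset.finite_toSet _)
    _ ≤ N := by
        rw [Set.ncard_coe_finset]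
        exact (Multiset.toFinset_card_le _).trans ((Polynomial.card_roots' p).trans hdeg)

/-- The first `r` coordinates form a Vandermonde matrix. -/
theorem linearIndependent_momentVec {r : ℕ} (hr : r ≤ N) {t : Fin r → ℝ}
    (ht : Function.Injective t) : LinearIndependent ℝ fun a => momentVec N (t a) := by
  let π : EuclideanSpace ℝ (Fin N) →ₗ[ℝ] (Fin r → ℝ) :=
    LinearMap.funLeft ℝ ℝ (Fin.castLE hr) ∘ₗ (WithLp.linearEquiv 2 ℝ (Fin N → ℝ)).toLinearMap
  refine LinearIndependent.of_comp π ?_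
  have := Matrix.linearIndependent_rows_of_det_ne_zero (Matrix.det_vandermonde_ne_zero_iff.2 ht)
  exact this

/-- Since the dimensions of the sum and of `Fᗮ` add up to `N`, failure to span means a nontrivial
intersection. This puts degeneracy in the form counted by `card_orthogonal_tuples_le`. -/
theorem not_mem_transversal_orthogonal {n r : ℕ} {V : Fin n → Submodule ℝ (EuclideanSpace ℝ (Fin N))}
    (hV : finrank ℝ ↥(⨆ i, V i) = r) {f : Fin r → EuclideanSpace ℝ (Fin N)}
    (hf : LinearIndependent ℝ f)
    (h : V ∉ transversal (Submodule.span ℝ (Set.range f))) :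
    ∃ w ∈ ⨆ i, V i, w ≠ 0 ∧ ∀ b, inner ℝ (f b) w = 0 := by
  set F := Submodule.span ℝ (Set.range f) with hF
  by_contra! hw
  refine h ?_
  have hinf : (⨆ i, V i) ⊓ Fᗮ = ⊥ := by
    rw [Submodule.eq_bot_iff]
    rintro w ⟨hwV, hwF⟩
    by_contra hne
    obtain ⟨b, hb⟩ := hw w hwV hne
    exact hb (hwF _ (Submodule.subset_span ⟨b, rfl⟩))
  have hFr : finrank ℝ F = r := by
    rw [hF, finrank_span_eq_card hf, Fintype.card_fin]
  refine Submodule.eq_top_of_finrank_eq ?_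
  have h₁ := Submodule.finrank_sup_add_finrank_inf_eq (⨆ i, V i) Fᗮ
  have h₂ := Submodule.finrank_add_finrank_orthogonal F
  rw [hinf, finrank_bot] at h₁
  omega

/-! ### Almost sure general position -/

variable {Ω : Type*} [MeasurableSpace Ω] {P : Measure Ω}

/-- For independent rotation invariant random subspaces, the probability of being in general
position relative to `F` depends on the dimension of `F` only. -/
theorem measure_transversal_eq {n : ℕ} {k : Fin n → ℕ}
    {V : (i : Fin n) → Ω → Submodule ℝ (EuclideanSpace ℝ (Fin N))}
    (hV : ∀ i, IsRandomSubspace P (k i) (V i)) (hind : iIndepFun V P)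
    (F G : Submodule ℝ (EuclideanSpace ℝ (Fin N))) (h : finrank ℝ F = finrank ℝ G) :
    P {ω | (fun i => V i ω) ∉ transversal F} = P {ω | (fun i => V i ω) ∉ transversal G} := by
  obtain ⟨O, rfl⟩ := exists_isometry_map_eq F G h
  have hid := IdentDistrib.pi (fun i => (hV i).invariant O)
    (hind.comp (fun _ W => W.map O.toLinearEquiv.toLinearMap) fun _ => measurable_submodule_map O)
    hind
  have := hid.measure_mem_eq
    (measurableSet_transversal (F.map O.toLinearEquiv.toLinearMap)).compl
  refine Eq.trans ?_ this
  congr 1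
  ext ω
  exact (not_congr (map_mem_transversal_iff F O fun i => V i ω)).symm

/-- The sum of independent rotation invariant random subspaces is almost surely in general
position relative to any fixed subspace `F` of the same dimension. -/
theorem ae_mem_transversal [IsProbabilityMeasure P] {n r : ℕ} {k : Fin n → ℕ}
    {V : (i : Fin n) → Ω → Submodule ℝ (EuclideanSpace ℝ (Fin N))}
    (hV : ∀ i, IsRandomSubspace P (k i) (V i)) (hind : iIndepFun V P)
    (hdim : ∀ᵐ ω ∂P, finrank ℝ ↥(⨆ i, V i ω) = r)
    (F : Submodule ℝ (EuclideanSpace ℝ (Fin N))) (hF : finrank ℝ F = r) :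
    ∀ᵐ ω ∂P, (fun i => V i ω) ∈ transversal F := by
  classical
  have hr : r ≤ N := by
    rw [← hF]
    simpa using Submodule.finrank_le F
  set p := P {ω | (fun i => V i ω) ∉ transversal F} with hp
  have hVm : AEMeasurable (fun ω i => V i ω) P :=
    aemeasurable_pi_lambda _ fun i => (hV i).aemeasurable
  have key : ∀ M : ℕ, 0 < M → (M : ENNReal) * p ≤ r * N := by
    intro M hM
    -- Pairing makes all `r * M` nodes distinct: across `b` for linear independence, across `j` for
    -- the root count.
    let t : Fin r → Fin M → ℝ := fun b j => (Nat.pair b j : ℝ)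
    let f : (Fin r → Fin M) → Fin r → EuclideanSpace ℝ (Fin N) := fun x b => momentVec N (t b (x b))
    have hf : ∀ x, LinearIndependent ℝ (f x) := fun x => by
      refine linearIndependent_momentVec hr fun b c hbc => Fin.ext ?_
      exact (Nat.pair_eq_pair.1 (Nat.cast_injective hbc)).1
    have ht : ∀ b, Function.Injective (t b) := fun b i j hij =>
      Fin.ext (Nat.pair_eq_pair.1 (Nat.cast_injective hij)).2
    let A : (Fin r → Fin M) → Set Ω := fun x =>
      {ω | (fun i => V i ω) ∉ transversal (Submodule.span ℝ (Set.range (f x)))}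
    have hA : ∀ x, P (A x) = p := fun x => by
      refine measure_transversal_eq hV hind _ _ ?_
      rw [finrank_span_eq_card (hf x), Fintype.card_fin, hF]
    have hAm : ∀ x, NullMeasurableSet (A x) P := fun x =>
      hVm.nullMeasurableSet_preimage (measurableSet_transversal _).compl
    have hcount : ∀ᵐ ω ∂P, (M : ENNReal) * ∑ x, (A x).indicator 1 ω ≤ r * N * M ^ r := by
      filter_upwards [hdim] with ω hω
      have h₁ := card_orthogonal_tuples_le N M r (fun b j => momentVec N (t b j))
        (fun b w hw => ncard_momentVec_orthogonal_le (ht b) w hw) (⨆ i, V i ω) hω.le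
      have h₂ : ∑ x, (A x).indicator (1 : Ω → ENNReal) ω = ({x | ω ∈ A x}.ncard : ENNReal) := by
        simp only [Set.indicator_apply, Pi.one_apply]
        rw [Finset.sum_boole, Set.ncard_eq_toFinset_card']
        congr 2
        ext x
        simp
      rw [h₂]
      have h₃ : {x | ω ∈ A x}.ncard ≤
          {x : Fin r → Fin M | ∃ w ∈ ⨆ i, V i ω, w ≠ 0 ∧
            ∀ b, inner ℝ (momentVec N (t b (x b))) w = 0}.ncard :=
        Set.ncard_le_ncard (fun x hx => not_mem_transversal_orthogonal hω (hf x) hx)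
          (Set.toFinite _)
      exact_mod_cast (Nat.mul_le_mul_left M h₃).trans h₁
    -- Double counting: the pointwise bound `hcount` is integrated, and all `M ^ r` events have the
    -- same probability `p`.
    have hint : ∫⁻ ω, (M : ENNReal) * ∑ x, (A x).indicator 1 ω ∂P = M * (M ^ r * p) := by
      rw [lintegral_const_mul' _ _ (ENNReal.natCast_ne_top M), lintegral_finsetSum']
      · simp_rw [lintegral_indicator_one₀ (hAm _), hA]
        simp
      · exact fun x _ => aemeasurable_one.indicator₀ (hAm x)
    have hle : (M : ENNReal) * (M ^ r * p) ≤ r * N * M ^ r := by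
      rw [← hint]
      refine (lintegral_mono_ae hcount).trans ?_
      simp
    have hM0 : (M : ENNReal) ^ r ≠ 0 := pow_ne_zero _ (by exact_mod_cast hM.ne')
    have hMt : (M : ENNReal) ^ r ≠ ⊤ := ENNReal.pow_ne_top (ENNReal.natCast_ne_top M)
    refine (ENNReal.mul_le_mul_iff_right hM0 hMt).1 ?_
    calc (M : ENNReal) ^ r * (M * p) = M * (M ^ r * p) := by ring
      _ ≤ r * N * M ^ r := hle
      _ = M ^ r * (r * N) := by ring
  have hp0 : p = 0 := by
    by_contra hne
    have hpt : p ≠ ⊤ := measure_ne_top P _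
    obtain ⟨M, hM⟩ := ENNReal.exists_nat_mul_gt hne (b := r * N)
      (ENNReal.mul_ne_top (ENNReal.natCast_ne_top r) (ENNReal.natCast_ne_top N))
    rcases Nat.eq_zero_or_pos M with rfl | hpos
    · simp at hM
    · exact absurd (key M hpos) (not_le.2 hM)
  exact ae_iff.2 hp0

/-! ### Coupon collecting with `r` classes -/

/-- If every set `g ⁻¹' {b}` has density at least `1 / (2 * r)`, then a uniform sample misses
one of them with probability at most `r * exp (-m / (2 * r))`. -/
theorem measureReal_miss_le [IsProbabilityMeasure P] {m r : ℕ} {S : Fin m → Ω → Fin N} (hS : IsUniformSample P S)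
    (g : Fin N → Fin r)
    (hg : ∀ b, (N : ℝ) / (2 * r) ≤ (Finset.univ.filter fun i => g i = b).card) :
    P.real {ω | ∃ b, ∀ j, g (S j ω) ≠ b} ≤ r * Real.exp (-(m / (2 * r))) := by
  classical
  have hone : ∀ b j, P.real {ω | g (S j ω) ≠ b} ≤ Real.exp (-(1 / (2 * r))) := by
    intro b j
    have hN : 0 < (N : ℝ) := by
      obtain ⟨ω⟩ := P.nonempty_of_neZero
      exact_mod_cast (S j ω).pos
    have hm : MeasurableSet {ω | g (S j ω) = b} :=
      hS.measurable j (Set.toFinite {i | g i = b}).measurableSet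
    have heq : P.real {ω | g (S j ω) = b} =
        (Finset.univ.filter fun i => g i = b).card * (1 / (N : ℝ)) := by
      have : {ω | g (S j ω) = b} =
          ⋃ i ∈ Finset.univ.filter fun i => g i = b, {ω | S j ω = i} := by
        ext ω
        simp
      rw [this, measureReal_biUnion_finset]
      · rw [Finset.sum_congr rfl fun i _ => hS.uniform j i, Finset.sum_const, nsmul_eq_mul]
      · intro i _ i' _ hne
        refine Set.disjoint_left.2 fun ω h h' => hne ?_
        exact Eq.trans (Eq.symm h) h'
      · exact fun i _ => hS.measurable j (measurableSet_singleton i)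
    have hcompl : P.real {ω | g (S j ω) ≠ b} = 1 - P.real {ω | g (S j ω) = b} :=
      probReal_compl_eq_one_sub hm
    have hdiv : 1 / (2 * (r : ℝ)) ≤ (Finset.univ.filter fun i => g i = b).card * (1 / (N : ℝ)) := by
      rw [mul_one_div, le_div_iff₀ hN]
      exact (le_of_eq (by ring)).trans (hg b)
    rw [hcompl, heq]
    have := Real.add_one_le_exp (-(1 / (2 * (r : ℝ))))
    linarith
  have hall : ∀ b, P.real {ω | ∀ j, g (S j ω) ≠ b} ≤ Real.exp (-(m / (2 * r))) := by
    intro b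
    have hind := hS.indep.measure_inter_preimage_eq_mul Finset.univ
      (sets := fun _ => {i | g i ≠ b}) fun _ _ => (Set.toFinite _).measurableSet
    have hset : {ω | ∀ j, g (S j ω) ≠ b} =
        ⋂ j ∈ (Finset.univ : Finset (Fin m)), S j ⁻¹' {i | g i ≠ b} := by
      ext ω
      simp
    rw [hset, measureReal_def, hind, ENNReal.toReal_prod]
    calc ∏ j : Fin m, (P (S j ⁻¹' {i | g i ≠ b})).toReal
        ≤ ∏ _j : Fin m, Real.exp (-(1 / (2 * r))) :=
          Finset.prod_le_prod (fun _ _ => ENNReal.toReal_nonneg) fun j _ => hone b j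
      _ = Real.exp (-(m / (2 * r))) := by
          rw [Finset.prod_const, Finset.card_univ, Fintype.card_fin, ← Real.exp_nat_mul]
          congr 1
          ring
  have hset : {ω | ∃ b, ∀ j, g (S j ω) ≠ b} =
      ⋃ b ∈ (Finset.univ : Finset (Fin r)), {ω | ∀ j, g (S j ω) ≠ b} := by
    ext ω
    simp
  rw [hset]
  refine (measureReal_biUnion_finset_le _ _).trans ?_
  refine (Finset.sum_le_sum fun b _ => hall b).trans ?_
  simp

/-- The residue classes modulo `r` split `{0, …, N - 1}` evenly. -/
theorem exists_balanced_partition {r : ℕ} (hr : 0 < r) (hrN : r ≤ N) :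
    ∃ g : Fin N → Fin r,
      ∀ b, (N : ℝ) / (2 * r) ≤ (Finset.univ.filter fun i => g i = b).card := by
  classical
  refine ⟨fun i => ⟨i % r, Nat.mod_lt _ hr⟩, fun b => ?_⟩
  have hq : N / r ≤ (Finset.univ.filter fun i : Fin N =>
      (⟨i % r, Nat.mod_lt _ hr⟩ : Fin r) = b).card := by
    have hlt : ∀ q : Fin (N / r), (b : ℕ) + r * q < N := fun q => by
      have h₁ : r * (q + 1) ≤ r * (N / r) := Nat.mul_le_mul_left r q.2
      have h₂ := Nat.mul_div_le N r
      have h₃ := b.2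
      rw [mul_add, mul_one] at h₁
      omega
    have := Finset.card_le_card_of_injOn (s := (Finset.univ : Finset (Fin (N / r))))
      (t := Finset.univ.filter fun i : Fin N => (⟨i % r, Nat.mod_lt _ hr⟩ : Fin r) = b)
      (fun q => ⟨b + r * q, hlt q⟩) (fun q _ => by
        simp [Fin.ext_iff, Nat.add_mul_mod_self_left, Nat.mod_eq_of_lt b.2])
      (fun q _ q' _ h => by
        have h' : (b : ℕ) + r * q = b + r * q' := congrArg Fin.val h
        exact Fin.ext (Nat.eq_of_mul_eq_mul_left hr (Nat.add_left_cancel h')))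
    simpa using this
  -- As `N / r ≥ 1`, rounding down costs at most a factor 2.
  have hnat : N ≤ 2 * r * (N / r) := by
    have h₁ := Nat.div_add_mod N r
    have h₂ := Nat.mod_lt N hr
    have h₃ : r * 1 ≤ r * (N / r) := Nat.mul_le_mul_left r (Nat.div_pos hrN hr)
    rw [mul_assoc]
    omega
  rw [div_le_iff₀ (by positivity)]
  calc (N : ℝ) ≤ 2 * r * (N / r : ℕ) := by exact_mod_cast hnat
    _ = (N / r : ℕ) * (2 * r) := by ring
    _ ≤ _ := by gcongr

end RowSampling

/-! ### Assembly of the bound -/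

theorem lemma3 :
    ∃ c : ℝ, 0 < c ∧
      ∀ {Ω : Type*} [MeasurableSpace Ω] (P : Measure Ω) [IsProbabilityMeasure P]
        (N₁ n r m₂ : ℕ) (d : Fin n → ℕ) (δ φ : ℝ)
        (L : Ω → Matrix (Fin N₁) ((i : Fin n) × Fin (d i)) ℝ)
        (S : Fin m₂ → Ω → Fin N₁),
        0 < r →
        0 < δ →
        RowSampling.FollowsSubspaceModel P N₁ n r d L →
        (∀ᵐ ω ∂P, (L ω).rank = r) →
        RowSampling.IsUniformSample P S →
        IndepFun (fun ω j => S j ω) L P →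
        φ = max (r : ℝ) (Real.log N₁) / r →
        10 * c * r * φ * Real.log (2 * r / δ) ≤ m₂ →
        1 - δ - 2 * (N₁ : ℝ) ^ (-3 : ℤ) ≤
          P.real {ω | RowSampling.rowSpace ((L ω).submatrix (fun j => S j ω) id) =
            RowSampling.rowSpace (L ω)} := by
  refine ⟨1, one_pos, ?_⟩
  intro Ω _ P _ N₁ n r m₂ d δ φ L S hr hδ hL hrank hS _ hφ hm
  obtain ⟨_, hnr, U, Q, _, _, hUQ, hU, hind, _⟩ := hL
  set good := {ω | RowSampling.rowSpace ((L ω).submatrix (fun j => S j ω) id) =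
    RowSampling.rowSpace (L ω)} with hgood
  have hN : (0 : ℝ) ≤ 2 * (N₁ : ℝ) ^ (-3 : ℤ) := by positivity
  rcases le_or_gt 1 δ with hδ1 | hδ1
  · have : 0 ≤ P.real good := measureReal_nonneg
    linarith
  have hrN : r ≤ N₁ := by
    obtain ⟨ω, hω⟩ := hrank.exists
    simpa [hω] using (L ω).rank_le_card_height
  have hcol : ∀ᵐ ω ∂P, RowSampling.colSpace (L ω) = ⨆ i, RowSampling.colSpace (U i ω) := by
    filter_upwards [hrank] with ω hω
    rw [hUQ] at hω ⊢
    refine RowSampling.colSpace_blockMatrix_eq _ _ ?_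
    rw [hω, Nat.mul_div_cancel' hnr]
  have hdim : ∀ᵐ ω ∂P, Module.finrank ℝ ↥(⨆ i, RowSampling.colSpace (U i ω)) = r := by
    filter_upwards [hcol, hrank] with ω h₁ h₂
    rw [← h₁, RowSampling.finrank_colSpace, h₂]
  -- There are finitely many `t`, so one null set serves them all, and `t` may later be chosen
  -- depending on `ω` through the sample.
  have hgen : ∀ᵐ ω ∂P, ∀ t : Fin r → Fin N₁, Function.Injective t →
      (⨆ i, RowSampling.colSpace (U i ω)) ⊔ (RowSampling.coordSpan t)ᗮ = ⊤ := by
    rw [ae_all_iff]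
    intro t
    by_cases ht : Function.Injective t
    · have := RowSampling.ae_mem_transversal hU hind hdim (RowSampling.coordSpan t)
        (by rw [RowSampling.finrank_coordSpan ht, Fintype.card_fin])
      filter_upwards [this] with ω hω _ using hω
    · exact Filter.Eventually.of_forall fun ω h => absurd h ht
  obtain ⟨g, hg⟩ := RowSampling.exists_balanced_partition hr hrN
  have hmiss := RowSampling.measureReal_miss_le hS g hg
  set miss := {ω | ∃ b, ∀ j, g (S j ω) ≠ b} with hmissdef
  have hae : ∀ᵐ ω ∂P, ω ∈ goodᶜ → ω ∈ miss := by
    filter_upwards [hcol, hrank, hgen] with ω h₁ h₂ h₃ hbad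
    by_contra hhit
    have hhit' : ∀ b, ∃ j, g (S j ω) = b := by
      by_contra! h
      exact hhit h
    choose s hs using hhit'
    have hinj : Function.Injective ((fun j => S j ω) ∘ s) := fun b b' h => by
      rw [← hs b, ← hs b']
      exact congrArg g h
    refine hbad (RowSampling.rowSpace_submatrix_eq (L ω) (fun j => S j ω) s ?_)
    rw [RowSampling.rank_submatrix_of_sup_eq_top (L ω) hinj (by rw [h₁]; exact h₃ _ hinj), h₂,
      Fintype.card_fin]
  have hbad : P.real goodᶜ ≤ P.real miss :=
    ENNReal.toReal_mono (measure_ne_top P _) (measure_mono_ae hae)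
  have hsum : 1 ≤ P.real good + P.real goodᶜ := by
    have := measureReal_union_le (μ := P) good goodᶜ
    rwa [Set.union_compl_self, probReal_univ] at this
  have hr' : (1 : ℝ) ≤ r := by exact_mod_cast hr
  have hbound : r * Real.exp (-((m₂ : ℝ) / (2 * r))) ≤ δ := by
    have hlog : 0 ≤ Real.log (2 * r / δ) := by
      refine Real.log_nonneg ?_
      rw [le_div_iff₀ hδ]
      linarith
    have hmax : (r : ℝ) * φ = max (r : ℝ) (Real.log N₁) := by
      rw [hφ, mul_div_cancel₀ _ (by positivity)]
    -- With `c = 1` the factor `10 * max r (log N₁)` exceeds the `2 * r` needed; the logarithm is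
    -- nonnegative because `δ < 1`.
    have hm' : 2 * r * Real.log (2 * r / δ) ≤ m₂ := by
      refine le_trans ?_ hm
      refine mul_le_mul_of_nonneg_right ?_ hlog
      have := le_max_left (r : ℝ) (Real.log N₁)
      rw [mul_assoc (10 * 1 : ℝ), hmax]
      linarith
    have hexp : Real.exp (-((m₂ : ℝ) / (2 * r))) ≤ δ / (2 * r) := by
      have h₁ : Real.log (2 * r / δ) ≤ (m₂ : ℝ) / (2 * r) := by
        rw [le_div_iff₀ (by positivity)]
        linarith
      calc Real.exp (-((m₂ : ℝ) / (2 * r))) ≤ Real.exp (-Real.log (2 * r / δ)) :=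
            Real.exp_le_exp.2 (neg_le_neg h₁)
        _ = δ / (2 * r) := by
            rw [Real.exp_neg, Real.exp_log (by positivity), inv_div]
    calc r * Real.exp (-((m₂ : ℝ) / (2 * r))) ≤ r * (δ / (2 * r)) := by gcongr
      _ = δ / 2 := by field_simp
      _ ≤ δ := by linarith
  linarith
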